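/- Let $\alpha\ge 0$, $\delta\in(0,\pi/2)$ and $d>0$ be fixed, and let $U_\delta=\{\lambda\in\mathbb{C}\setminus\{0\} : |\operatorname{Arg}\lambda|<\pi-\delta\}$. Consider the transfer function of the (damped) wave equation $\partial_t^2u+\alpha\,\partial_tu-\Delta u=0$, given by $$K(\lambda,d)=\begin{cases}\dfrac{1}{2\pi}\,K_0\!\left(\sqrt{\lambda^2+\alpha\lambda}\;d\right) & \text{in two dimensions},\\[2mm] \dfrac{e^{-\sqrt{\lambda^2+\alpha\lambda}\;d}}{4\pi d} & \text{in three dimensions},\end{cases}$$ where $K_0$ is the modified Bessel function of the second kind of order zero (principal branch on $\mathbb{C}\setminus(-\infty,0]$) and $\sqrt{\lambda^2+\alpha\lambda}=\sqrt{\lambda}\,\sqrt{\lambda+\alpha}$ (principal square roots) is the branch that is analytic on $\mathbb{C}\setminus(-\infty,0]$ and positive for $\lambda>0$. Then $\lambda\mapsto K(\lambda,d)$ is analytic on $U_\delta$, and there is a constant $C$, depending only on $d$, $\delta$ and $\alpha$, such that $$\left|e^{\lambda d}K(\lambda,d)\right|\le C\,|\lambda|^{\mu}\qquad\text{for all }\lambda\in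 U_\delta,$$ with $\mu=-1/2$ in two dimensions and $\mu=0$ in three dimensions. -/

import Mathlib

noncomputable section

namespace WaveKernel

/-- The modified Bessel function `I₀(z) = ∑ₖ (z²/4)ᵏ / (k!)²`, an entire function. -/
def besselI0 (z : ℂ) : ℂ :=
  ∑' k : ℕ, (z ^ 2 / 4) ^ k / ((Nat.factorial k : ℂ) ^ 2)

/-- The modified Bessel function of the second kind of order zero,
`K₀(z) = -(log (z/2) + γ) I₀(z) + ∑ₖ Hₖ (z²/4)ᵏ / (k!)²`,
where `γ` is Euler's constant, `Hₖ = 1 + 1/2 + ⋯ + 1/k` and `log` is the principal logarithm.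
This is the principal branch of `K₀`, analytic on `ℂ ∖ (-∞, 0]`. -/
def besselK0 (z : ℂ) : ℂ :=
  -(Complex.log (z / 2) + (Real.eulerMascheroniConstant : ℂ)) * besselI0 z +
    ∑' k : ℕ, ((harmonic k : ℚ) : ℂ) * ((z ^ 2 / 4) ^ k / ((Nat.factorial k : ℂ) ^ 2))

/-- The open sector `U_δ = {z ≠ 0 : |Arg z| < π - δ}`. The origin, where the argument is not
defined (Lean's `Complex.arg 0` is `0`), does not belong to it. -/
def sector (δ : ℝ) : Set ℂ :=
  {z : ℂ | z ≠ 0 ∧ |Complex.arg z| < Real.pi - δ}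

/-- The square root `√(z² + α z)`, `α ≥ 0`: the branch that is analytic on `ℂ ∖ (-∞, 0]` and
positive for `z > 0`, written with principal square roots as `√z √(z + α)`. It is `z` for `α = 0`.
(The principal root of `z² + α z` itself would jump across the line `Re z = -α/2`.) -/
def dampedRoot (α : ℝ) (z : ℂ) : ℂ :=
  z ^ (1 / 2 : ℂ) * (z + (α : ℂ)) ^ (1 / 2 : ℂ)

/-- Transfer function of `∂ₜ² u + α ∂ₜ u - Δ u = 0` in two space dimensions. -/
def transfer2D (α : ℝ) (z : ℂ) (d : ℝ) : ℂ :=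
  1 / (2 * (Real.pi : ℂ)) * besselK0 (dampedRoot α z * (d : ℂ))

/-- Transfer function of `∂ₜ² u + α ∂ₜ u - Δ u = 0` in three space dimensions. -/
def transfer3D (α : ℝ) (z : ℂ) (d : ℝ) : ℂ :=
  Complex.exp (-(dampedRoot α z * (d : ℂ))) / (4 * (Real.pi : ℂ) * (d : ℂ))

/-- `K(·, d)` is analytic on the sector `U_δ` and satisfies the shifted sectorial bound
`|e^{z d} K(z, d)| ≤ C |z|^μ` there, with a constant `C` independent of `z`. -/
def ShiftedSectorialBound (K : ℂ → ℝ → ℂ) (δ μ d : ℝ) : Prop :=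
  AnalyticOnNhd ℂ (fun z => K z d) (sector δ) ∧
    ∃ C : ℝ, ∀ z ∈ sector δ, ‖Complex.exp (z * (d : ℂ)) * K z d‖ ≤ C * ‖z‖ ^ μ

end WaveKernel

end

noncomputable section

namespace WaveKernel

open MeasureTheory Set Filter Topology

/-! The 2D bound rests on `K₀(z) = e⁻ᶻ F(z)` with `F(z) = ∫₀^∞ e⁻ᵘ u^(-1/2) (u + 2z)^(-1/2) du`
(`besselK0_eq_laplaceK`). In the sector, `|u + 2z| ≥ 2 |z| sin δ`, hence `F(z) = O(|z|^(-1/2))`.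

Since `K₀` is defined by its series, this representation must be proved. Both sides solve `z (z g')'
= z² g` on the slit plane, and both are `-log (x/2) - γ + o(1)` as `x → 0⁺`. Their difference is a
solution tending to `0` at the origin, so it vanishes (`eq_zero_of_bessel_equation`): on the reals
near `0` by a contraction estimate, then everywhere by the identity theorem.

Damping replaces `λ` by `w = √λ √(λ + α)`. Three facts suffice: `w` stays in the sector
(`dampedRoot_mem_sector`), `|w| ≥ sin δ |λ|` (`sin_mul_norm_le_norm_dampedRoot`), and `|w - λ| ≤ α`
(`norm_dampedRoot_sub_le`). The last gives `|e^{λd} e^{-wd}| ≤ e^{αd}`, which is already the 3D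
bound. -/

/-! ### Even entire power series and the Bessel coefficients. -/

/-- Coefficients of an everywhere convergent power series. -/
def EntireCoeff (c : ℕ → ℂ) : Prop :=
  ∀ r : ℝ, 0 ≤ r → Summable fun k => ‖c k‖ * r ^ k

/-- The even power series `∑ₖ cₖ (z²/4)ᵏ`. -/
def evenSeries (c : ℕ → ℂ) (z : ℂ) : ℂ := ∑' k : ℕ, c k * (z ^ 2 / 4) ^ k

/-- The factor `2 ^ k` is absorbed by passing from radius `r` to `2 * r`. -/
lemma EntireCoeff.mul {c m : ℕ → ℂ} (hc : EntireCoeff c) (hm : ∀ k, ‖m k‖ ≤ 2 ^ k) :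
    EntireCoeff fun k => m k * c k := by
  intro r hr
  refine Summable.of_nonneg_of_le (fun k => by positivity) (fun k => ?_) (hc (2 * r) (by positivity))
  rw [norm_mul, mul_pow]
  calc ‖m k‖ * ‖c k‖ * r ^ k ≤ 2 ^ k * ‖c k‖ * r ^ k := by gcongr; exact hm k
    _ = ‖c k‖ * (2 ^ k * r ^ k) := by ring

lemma EntireCoeff.natCast_mul {c : ℕ → ℂ} (hc : EntireCoeff c) :
    EntireCoeff fun k => (k : ℂ) * c k := by
  refine hc.mul (m := fun k => (k : ℂ)) fun k => ?_
  rw [Complex.norm_natCast]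
  exact_mod_cast (Nat.lt_two_pow_self (n := k)).le

lemma EntireCoeff.summable {c : ℕ → ℂ} (hc : EntireCoeff c) (z : ℂ) :
    Summable fun k => c k * (z ^ 2 / 4) ^ k := by
  have h := hc ‖z ^ 2 / 4‖ (norm_nonneg _)
  simp only [← norm_pow, ← norm_mul] at h
  exact h.of_norm

lemma norm_evenSeries_term_le (c : ℕ → ℂ) {R : ℝ} {w : ℂ} (hw : w ∈ Metric.ball (0 : ℂ) R)
    (k : ℕ) : ‖c k * (w ^ 2 / 4) ^ k‖ ≤ ‖c k‖ * (R ^ 2 / 4) ^ k := by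
  have hw' : ‖w‖ ≤ R := by simpa using (Metric.mem_ball.1 hw).le
  rw [norm_mul, norm_pow, norm_div, norm_pow]
  have : ‖(4 : ℂ)‖ = 4 := by simp
  rw [this]
  gcongr

lemma differentiable_evenSeries {c : ℕ → ℂ} (hc : EntireCoeff c) :
    Differentiable ℂ (evenSeries c) := by
  intro z
  have hz : z ∈ Metric.ball (0 : ℂ) (‖z‖ + 1) := by simp
  have := Complex.differentiableOn_tsum_of_summable_norm
    (hc ((‖z‖ + 1) ^ 2 / 4) (by positivity)) (F := fun k w => c k * (w ^ 2 / 4) ^ k)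
    (fun k => by fun_prop) Metric.isOpen_ball
    (fun k w hw => norm_evenSeries_term_le c hw k)
  exact this.differentiableAt (Metric.isOpen_ball.mem_nhds hz)

/-- The operator `z d/dz` multiplies the `k`-th coefficient by `2k`. Writing the derivative as a
quotient by `z` turns the Bessel equation into a recurrence for coefficients. -/
lemma hasDerivAt_evenSeries {c : ℕ → ℂ} (hc : EntireCoeff c) {z : ℂ} (hz : z ≠ 0) :
    HasDerivAt (evenSeries c) (2 * evenSeries (fun k => (k : ℂ) * c k) z / z) z := by
  have hzb : z ∈ Metric.ball (0 : ℂ) (‖z‖ + 1) := by simp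
  have h1 := Complex.hasSum_deriv_of_summable_norm
    (hc ((‖z‖ + 1) ^ 2 / 4) (by positivity)) (F := fun k w => c k * (w ^ 2 / 4) ^ k)
    (fun k => by fun_prop) Metric.isOpen_ball
    (fun k w hw => norm_evenSeries_term_le c hw k) hzb
  have h2 : HasSum (fun k : ℕ => 2 / z * ((k : ℂ) * c k * (z ^ 2 / 4) ^ k))
      (2 / z * evenSeries (fun k => (k : ℂ) * c k) z) :=
    (hc.natCast_mul.summable z).hasSum.mul_left _
  have h3 : ∀ k : ℕ, deriv (fun w => c k * (w ^ 2 / 4) ^ k) z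
      = 2 / z * ((k : ℂ) * c k * (z ^ 2 / 4) ^ k) := by
    intro k
    have h : HasDerivAt (fun w : ℂ => c k * (w ^ 2 / 4) ^ k)
        (c k * ((k : ℂ) * (z ^ 2 / 4) ^ (k - 1) * ((2 : ℕ) * z ^ (2 - 1) / 4))) z :=
      (((hasDerivAt_pow 2 z).div_const 4).pow k).const_mul _
    rw [h.deriv]
    rcases k with _ | k
    · simp
    · simp only [Nat.add_sub_cancel, pow_succ (z ^ 2 / 4) k]
      field_simp
      push_cast
      ring
  simp only [h3] at h1
  have h4 := h1.unique h2
  have h5 := (differentiable_evenSeries hc z).hasDerivAt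
  have h6 : deriv (evenSeries c) z = 2 * evenSeries (fun k => (k : ℂ) * c k) z / z := by
    rw [show 2 * evenSeries (fun k => (k : ℂ) * c k) z / z
      = 2 / z * evenSeries (fun k => (k : ℂ) * c k) z by ring, ← h4]
    rfl
  rwa [h6] at h5

/-- The coefficients `1 / (k!)²` of `I₀`. -/
def besselCoeff (k : ℕ) : ℂ := 1 / (Nat.factorial k : ℂ) ^ 2

/-- The coefficients `Hₖ / (k!)²` of the regular part of `K₀`. -/
def harmonicCoeff (k : ℕ) : ℂ := ((harmonic k : ℚ) : ℂ) * besselCoeff k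

lemma entireCoeff_bessel : EntireCoeff besselCoeff := by
  intro r hr
  refine Summable.of_nonneg_of_le (fun k => by positivity) (fun k => ?_)
    (Real.summable_pow_div_factorial r)
  have h1 : (1 : ℝ) ≤ (Nat.factorial k : ℝ) := by exact_mod_cast Nat.factorial_pos k
  rw [besselCoeff, norm_div, norm_pow, Complex.norm_natCast, norm_one, one_div_mul_eq_div]
  exact div_le_div_of_nonneg_left (by positivity) (by positivity) (by nlinarith)

lemma norm_harmonic_le (k : ℕ) : ‖((harmonic k : ℚ) : ℂ)‖ ≤ 2 ^ k := by
  have h : ∀ k : ℕ, 0 ≤ harmonic k ∧ harmonic k ≤ k := by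
    intro k
    induction k with
    | zero => simp
    | succ k ih =>
      rw [harmonic_succ]
      have h1 : ((k + 1 : ℕ) : ℚ)⁻¹ ≤ 1 := inv_le_one_of_one_le₀ (by push_cast; linarith [k.cast_nonneg (α := ℚ)])
      have h2 : (0 : ℚ) ≤ ((k + 1 : ℕ) : ℚ)⁻¹ := by positivity
      constructor
      · linarith [ih.1]
      · push_cast at *; linarith [ih.2]
  have h2 : (k : ℝ) ≤ 2 ^ k := by exact_mod_cast Nat.lt_two_pow_self.le
  have h3 : ((harmonic k : ℚ) : ℝ) ≤ k := by exact_mod_cast (h k).2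
  have h4 : (0 : ℝ) ≤ ((harmonic k : ℚ) : ℝ) := by exact_mod_cast (h k).1
  rw [Complex.norm_ratCast, abs_of_nonneg h4]
  linarith

lemma entireCoeff_harmonic : EntireCoeff harmonicCoeff :=
  entireCoeff_bessel.mul norm_harmonic_le

lemma besselI0_eq_evenSeries : besselI0 = evenSeries besselCoeff := by
  ext z
  exact tsum_congr fun k => by rw [besselCoeff]; ring

lemma besselK0_eq (z : ℂ) : besselK0 z =
    -(Complex.log (z / 2) + (Real.eulerMascheroniConstant : ℂ)) * evenSeries besselCoeff z +
      evenSeries harmonicCoeff z := by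
  rw [besselK0, besselI0_eq_evenSeries]
  congr 1
  exact tsum_congr fun k => by rw [harmonicCoeff, besselCoeff]; ring

lemma besselCoeff_succ (k : ℕ) :
    ((k + 1 : ℕ) : ℂ) * (((k + 1 : ℕ) : ℂ) * besselCoeff (k + 1)) = besselCoeff k := by
  have h1 : (Nat.factorial k : ℂ) ≠ 0 := by exact_mod_cast Nat.factorial_ne_zero k
  have h2 : (k : ℂ) + 1 ≠ 0 := by exact_mod_cast Nat.succ_ne_zero k
  simp only [besselCoeff, Nat.factorial_succ]
  push_cast
  field_simp

lemma evenSeries_eq_shift {c : ℕ → ℂ} (hc : EntireCoeff c) (h0 : c 0 = 0) (z : ℂ) :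
    evenSeries c z = z ^ 2 / 4 * ∑' k : ℕ, c (k + 1) * (z ^ 2 / 4) ^ k := by
  rw [evenSeries, (hc.summable z).tsum_eq_zero_add, h0, ← tsum_mul_left]
  simp only [zero_mul, zero_add]
  exact tsum_congr fun k => by ring

lemma evenSeries_besselCoeff_ode (z : ℂ) :
    4 * evenSeries (fun k => (k : ℂ) * ((k : ℂ) * besselCoeff k)) z
      = z ^ 2 * evenSeries besselCoeff z := by
  rw [evenSeries_eq_shift entireCoeff_bessel.natCast_mul.natCast_mul (by simp)]
  simp only [besselCoeff_succ, evenSeries]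
  ring

/-- With `c` the Bessel coefficients, `(k+1)² H_{k+1} c_{k+1} = H_k c_k + (k+1) c_{k+1}`. The extra
series is what the derivative of the logarithm in `K₀` will cancel. -/
lemma evenSeries_harmonicCoeff_ode (z : ℂ) :
    4 * evenSeries (fun k => (k : ℂ) * ((k : ℂ) * harmonicCoeff k)) z
      = z ^ 2 * evenSeries harmonicCoeff z
        + 4 * evenSeries (fun k => (k : ℂ) * besselCoeff k) z := by
  rw [evenSeries_eq_shift entireCoeff_harmonic.natCast_mul.natCast_mul (by simp),
    evenSeries_eq_shift entireCoeff_bessel.natCast_mul (by simp)]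
  have hs : Summable fun k : ℕ => ((k + 1 : ℕ) : ℂ) * besselCoeff (k + 1) * (z ^ 2 / 4) ^ k := by
    rcases eq_or_ne (z ^ 2 / 4) 0 with h | h
    · rw [h]
      exact summable_of_ne_finset_zero (s := {0}) (fun k hk => by
        rw [zero_pow (by simpa using hk), mul_zero])
    · have := (summable_nat_add_iff 1).2 (entireCoeff_bessel.natCast_mul.summable z)
      refine (this.mul_left (z ^ 2 / 4)⁻¹).congr fun k => ?_
      generalize z ^ 2 / 4 = q at h ⊢
      rw [pow_succ]
      field_simp
  have : ∑' k : ℕ, ((k + 1 : ℕ) : ℂ) * (((k + 1 : ℕ) : ℂ) * harmonicCoeff (k + 1)) * (z ^ 2 / 4) ^ k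
      = evenSeries harmonicCoeff z
        + ∑' k : ℕ, ((k + 1 : ℕ) : ℂ) * besselCoeff (k + 1) * (z ^ 2 / 4) ^ k := by
    rw [evenSeries, ← (entireCoeff_harmonic.summable z).tsum_add hs]
    refine tsum_congr fun k => ?_
    have h2 : ((k + 1 : ℕ) : ℂ) ≠ 0 := by exact_mod_cast Nat.succ_ne_zero k
    rw [harmonicCoeff, harmonicCoeff, ← besselCoeff_succ k, harmonic_succ]
    push_cast at *
    field_simp
  rw [this]
  ring

/-! ### The modified Bessel equation for `K₀`. -/

/-- `z K₀'(z)`. -/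
def besselK0Theta (z : ℂ) : ℂ :=
  -(Complex.log (z / 2) + (Real.eulerMascheroniConstant : ℂ))
      * (2 * evenSeries (fun k => (k : ℂ) * besselCoeff k) z)
    - evenSeries besselCoeff z + 2 * evenSeries (fun k => (k : ℂ) * harmonicCoeff k) z

lemma hasDerivAt_log_half {z : ℂ} (hz : z ∈ Complex.slitPlane) :
    HasDerivAt (fun w => -(Complex.log (w / 2) + (Real.eulerMascheroniConstant : ℂ))) (-z⁻¹) z := by
  have hz2 : z / 2 ∈ Complex.slitPlane := by
    rw [Complex.mem_slitPlane_iff] at hz ⊢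
    simpa using hz
  have hz0 := Complex.slitPlane_ne_zero hz
  have h := ((((hasDerivAt_id z).div_const 2).clog hz2).add_const
    (Real.eulerMascheroniConstant : ℂ)).neg
  refine h.congr_deriv ?_
  simp only [id]
  field_simp

lemma hasDerivAt_besselK0 {z : ℂ} (hz : z ∈ Complex.slitPlane) :
    HasDerivAt besselK0 (besselK0Theta z / z) z := by
  have hz0 := Complex.slitPlane_ne_zero hz
  rw [show besselK0 = _ from funext besselK0_eq]
  refine (((hasDerivAt_log_half hz).mul (hasDerivAt_evenSeries entireCoeff_bessel hz0)).add
    (hasDerivAt_evenSeries entireCoeff_harmonic hz0)).congr_deriv ?_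
  rw [besselK0Theta]
  field_simp
  ring

/-- Together with `hasDerivAt_besselK0` this is the modified Bessel equation as a first-order system
for `(K, z K')`. -/
lemma hasDerivAt_besselK0Theta {z : ℂ} (hz : z ∈ Complex.slitPlane) :
    HasDerivAt besselK0Theta (z * besselK0 z) z := by
  have hz0 := Complex.slitPlane_ne_zero hz
  refine ((((hasDerivAt_log_half hz).mul
    ((hasDerivAt_evenSeries entireCoeff_bessel.natCast_mul hz0).const_mul 2)).sub
    (hasDerivAt_evenSeries entireCoeff_bessel hz0)).add
    ((hasDerivAt_evenSeries entireCoeff_harmonic.natCast_mul hz0).const_mul 2)).congr_deriv ?_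
  have h1 := evenSeries_besselCoeff_ode z
  have h2 := evenSeries_harmonicCoeff_ode z
  rw [besselK0_eq]
  generalize evenSeries (fun k => (k : ℂ) * ((k : ℂ) * besselCoeff k)) z = B at *
  generalize evenSeries (fun k => (k : ℂ) * ((k : ℂ) * harmonicCoeff k)) z = H at *
  field_simp
  linear_combination (Complex.log (z / 2) + (Real.eulerMascheroniConstant : ℂ)) * (-h1) + h2

/-! ### The Laplace-type integral and its differential equation. -/

/-- The weight `e⁻ᵘ u^(-1/2)`. -/
def gammaWeight (u : ℝ) : ℝ := Real.exp (-u) * u ^ ((1 / 2 : ℝ) - 1)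

lemma integrableOn_gammaWeight : IntegrableOn gammaWeight (Ioi 0) :=
  Real.GammaIntegral_convergent one_half_pos

lemma gammaWeight_nonneg {u : ℝ} (hu : 0 ≤ u) : 0 ≤ gammaWeight u := by
  unfold gammaWeight; positivity

/-- The integrand of `laplaceIntegral`. -/
def laplaceIntegrand (s : ℝ) (z : ℂ) (u : ℝ) : ℂ :=
  (gammaWeight u : ℂ) * ((u : ℂ) + 2 * z) ^ (-(s : ℂ))

/-- `∫₀^∞ e⁻ᵘ u^(-1/2) (u + 2z)⁻ˢ du`; for `s = 1/2` this is `eᶻ K₀(z)`. -/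
def laplaceIntegral (s : ℝ) (z : ℂ) : ℂ := ∫ u in Ioi (0 : ℝ), laplaceIntegrand s z u

lemma add_two_mul_mem_slitPlane {z : ℂ} (hz : z ∈ Complex.slitPlane) {u : ℝ} (hu : 0 ≤ u) :
    (u : ℂ) + 2 * z ∈ Complex.slitPlane := by
  rw [Complex.mem_slitPlane_iff] at hz ⊢
  rcases hz with h | h
  · left; simp; linarith
  · right; simpa using h

/-- Keeps `u + 2z` away from `0` uniformly in `u ≥ 0` and locally in `z`, which gives the domination
needed to differentiate under the integral. -/
lemma exists_ball_lower_bound {z₀ : ℂ} (hz₀ : z₀ ∈ Complex.slitPlane) :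
    ∃ r > 0, ∀ z ∈ Metric.ball z₀ r, z ∈ Complex.slitPlane ∧
      ∀ u : ℝ, 0 ≤ u → r ≤ ‖(u : ℂ) + 2 * z‖ := by
  obtain ⟨r, hr, hb⟩ := Metric.isOpen_iff.1 Complex.isOpen_slitPlane z₀ hz₀
  refine ⟨r / 2, by positivity, fun z hz => ⟨hb (Metric.ball_subset_ball (by linarith) hz), ?_⟩⟩
  intro u hu
  by_contra! h
  -- If `u + 2z` were small, the point `-u/2` of the cut would be close to `z`, hence inside a ball
  -- contained in the slit plane.
  have h1 : (-(u / 2 : ℝ) : ℂ) ∈ Metric.ball z₀ r := by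
    rw [Metric.mem_ball, dist_eq_norm] at *
    have e : (-(u / 2 : ℝ) : ℂ) - z₀ = (z - z₀) - ((u : ℂ) + 2 * z) / 2 := by push_cast; ring
    rw [e]
    refine (norm_sub_le _ _).trans_lt ?_
    rw [norm_div, Complex.norm_ofNat]
    linarith
  have h2 := hb h1
  rw [Complex.mem_slitPlane_iff] at h2
  rcases h2 with h | h
  · rw [← Complex.ofReal_neg, Complex.ofReal_re] at h; linarith
  · rw [← Complex.ofReal_neg] at h; simp at h

lemma norm_laplaceIntegrand_le {s r u : ℝ} {z : ℂ} (hs : 0 ≤ s) (hr : 0 < r) (hu : 0 ≤ u)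
    (h : r ≤ ‖(u : ℂ) + 2 * z‖) : ‖laplaceIntegrand s z u‖ ≤ gammaWeight u * r ^ (-s) := by
  rw [laplaceIntegrand, norm_mul, Complex.norm_real, Real.norm_of_nonneg (gammaWeight_nonneg hu),
    ← Complex.ofReal_neg, Complex.norm_cpow_real]
  exact mul_le_mul_of_nonneg_left (Real.rpow_le_rpow_of_nonpos hr h (by linarith))
    (gammaWeight_nonneg hu)

lemma aestronglyMeasurable_laplaceIntegrand (s : ℝ) (z : ℂ) :
    AEStronglyMeasurable (laplaceIntegrand s z) (volume.restrict (Ioi 0)) := by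
  unfold laplaceIntegrand gammaWeight
  exact (by fun_prop : Measurable _).aestronglyMeasurable

lemma integrableOn_laplaceIntegrand {s : ℝ} (hs : 0 ≤ s) {z : ℂ} (hz : z ∈ Complex.slitPlane) :
    IntegrableOn (laplaceIntegrand s z) (Ioi 0) := by
  obtain ⟨r, hr, hb⟩ := exists_ball_lower_bound hz
  refine Integrable.mono' (integrableOn_gammaWeight.mul_const (r ^ (-s)))
    (aestronglyMeasurable_laplaceIntegrand s z) ?_
  filter_upwards [ae_restrict_mem measurableSet_Ioi] with u hu
  exact norm_laplaceIntegrand_le hs hr hu.le ((hb z (Metric.mem_ball_self hr)).2 u hu.le)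

lemma hasDerivAt_laplaceIntegrand (s : ℝ) {z : ℂ} (hz : z ∈ Complex.slitPlane) {u : ℝ}
    (hu : 0 ≤ u) : HasDerivAt (fun z => laplaceIntegrand s z u)
      (-2 * s * laplaceIntegrand (s + 1) z u) z := by
  have h1 : HasDerivAt (fun z : ℂ => (u : ℂ) + 2 * z) (2 * 1) z :=
    ((hasDerivAt_id z).const_mul 2).const_add _
  refine ((h1.cpow_const (c := -(s : ℂ)) (add_two_mul_mem_slitPlane hz hu)).const_mul
    (gammaWeight u : ℂ)).congr_deriv ?_
  rw [laplaceIntegrand, show -((s + 1 : ℝ) : ℂ) = -(s : ℂ) - 1 by push_cast; ring]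
  ring

lemma hasDerivAt_laplaceIntegral {s : ℝ} (hs : 0 ≤ s) {z : ℂ} (hz : z ∈ Complex.slitPlane) :
    HasDerivAt (laplaceIntegral s) (-2 * s * laplaceIntegral (s + 1) z) z := by
  obtain ⟨r, hr, hb⟩ := exists_ball_lower_bound hz
  have h := (hasDerivAt_integral_of_dominated_loc_of_deriv_le
    (μ := volume.restrict (Ioi (0 : ℝ))) (F := fun z u => laplaceIntegrand s z u)
    (F' := fun z u => -2 * s * laplaceIntegrand (s + 1) z u)
    (bound := fun u => 2 * s * (gammaWeight u * r ^ (-(s + 1))))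
    (Metric.ball_mem_nhds z hr)
    (Eventually.of_forall fun w => aestronglyMeasurable_laplaceIntegrand s w)
    (integrableOn_laplaceIntegrand hs hz)
    ((aestronglyMeasurable_laplaceIntegrand (s + 1) z).const_mul _) ?_ ?_ ?_).2
  · rw [laplaceIntegral, ← integral_const_mul]
    exact h
  · filter_upwards [ae_restrict_mem measurableSet_Ioi] with u hu w hw
    rw [norm_mul]
    have : ‖(-2 * s : ℂ)‖ = 2 * s := by
      rw [norm_mul, Complex.norm_real, Real.norm_of_nonneg hs]; simp
    rw [this]
    exact mul_le_mul_of_nonneg_left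
      (norm_laplaceIntegrand_le (by linarith) hr hu.le ((hb w hw).2 u hu.le)) (by linarith)
  · exact (integrableOn_gammaWeight.mul_const _).const_mul _
  · filter_upwards [ae_restrict_mem measurableSet_Ioi] with u hu w hw
    exact hasDerivAt_laplaceIntegrand s (hb w hw).1 hu.le

lemma norm_laplaceIntegral_le {s r : ℝ} {z : ℂ} (hs : 0 ≤ s) (hr : 0 < r)
    (h : ∀ u : ℝ, 0 ≤ u → r ≤ ‖(u : ℂ) + 2 * z‖) :
    ‖laplaceIntegral s z‖ ≤ (∫ u in Ioi (0 : ℝ), gammaWeight u) * r ^ (-s) := by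
  rw [← integral_mul_const]
  refine norm_integral_le_of_norm_le (integrableOn_gammaWeight.mul_const _) ?_
  filter_upwards [ae_restrict_mem measurableSet_Ioi] with u hu
  exact norm_laplaceIntegrand_le hs hr hu.le (h u hu.le)

/-- The differential equation for `F(z) = eᶻ K₀(z)`: `z F'' + (1 - 2z) F' - F = 0`. -/
lemma laplaceIntegral_ode {z : ℂ} (hz : z ∈ Complex.slitPlane) :
    3 * z * laplaceIntegral (5 / 2) z - (1 - 2 * z) * laplaceIntegral (3 / 2) z
      - laplaceIntegral (1 / 2) z = 0 := by
  have i1 := integrableOn_laplaceIntegrand (s := 1 / 2) (by norm_num) hz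
  have i3 := integrableOn_laplaceIntegrand (s := 3 / 2) (by norm_num) hz
  have i5 := integrableOn_laplaceIntegrand (s := 5 / 2) (by norm_num) hz
  have hI := ((i5.const_mul (3 * z)).sub (i3.const_mul (1 - 2 * z))).sub i1
  obtain ⟨r, hr, hb⟩ := exists_ball_lower_bound hz
  have hlow := (hb z (Metric.mem_ball_self hr)).2
  -- The combined integrand is the `u`-derivative of `e⁻ᵘ u^(1/2) (u + 2z)^(-3/2)`, which vanishes
  -- at `0` and at infinity.
  have key := integral_Ioi_of_hasDerivAt_of_tendsto (a := 0) (m := 0)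
    (f := fun u : ℝ => ((Real.exp (-u) * u ^ (1 / 2 : ℝ) : ℝ) : ℂ)
      * ((u : ℂ) + 2 * z) ^ (-((3 / 2 : ℝ) : ℂ))) ?_ ?_ hI ?_
  · rw [integral_sub' ((i5.const_mul _).sub (i3.const_mul _)) i1,
      integral_sub' (i5.const_mul _) (i3.const_mul _), integral_const_mul, integral_const_mul] at key
    refine key.trans ?_
    simp
  · refine ContinuousAt.continuousWithinAt ?_
    have h0 : ((0 : ℝ) : ℂ) + 2 * z ∈ Complex.slitPlane := add_two_mul_mem_slitPlane hz le_rfl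
    refine ContinuousAt.mul ?_ ?_
    · refine Complex.continuous_ofReal.continuousAt.comp ?_
      exact (by fun_prop : ContinuousAt (fun u : ℝ => Real.exp (-u)) 0).mul
        (Real.continuousAt_rpow_const _ _ (Or.inr (by norm_num)))
    · exact ContinuousAt.cpow (by fun_prop) continuousAt_const h0
  · intro u hu
    have hu : 0 < u := hu
    have hsl := add_two_mul_mem_slitPlane hz hu.le
    have hne := Complex.slitPlane_ne_zero hsl
    have d1 : HasDerivAt (fun u : ℝ => Real.exp (-u) * u ^ (1 / 2 : ℝ))
        (Real.exp (-u) * (-1) * u ^ (1 / 2 : ℝ)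
          + Real.exp (-u) * (1 / 2 * u ^ ((1 / 2 : ℝ) - 1))) u :=
      ((hasDerivAt_neg u).exp).mul (Real.hasDerivAt_rpow_const (Or.inl hu.ne'))
    have d2 : HasDerivAt (fun u : ℝ => ((u : ℂ) + 2 * z) ^ (-((3 / 2 : ℝ) : ℂ)))
        (-((3 / 2 : ℝ) : ℂ) * ((u : ℂ) + 2 * z) ^ (-((3 / 2 : ℝ) : ℂ) - 1) * 1) u :=
      HasDerivAt.comp_ofReal (((hasDerivAt_id (u : ℂ)).add_const (2 * z)).cpow_const hsl)
    refine (d1.ofReal_comp.mul d2).congr_deriv ?_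
    have hu1 : u ^ (1 / 2 : ℝ) = u * u ^ ((1 / 2 : ℝ) - 1) := by
      rw [Real.rpow_sub_one hu.ne']; field_simp
    have p5 : ((u : ℂ) + 2 * z) ^ (-((3 / 2 : ℝ) : ℂ) - 1)
        = ((u : ℂ) + 2 * z) ^ (-((5 / 2 : ℝ) : ℂ)) := by
      congr 1; push_cast; ring
    have p3 : ((u : ℂ) + 2 * z) ^ (-((3 / 2 : ℝ) : ℂ))
        = ((u : ℂ) + 2 * z) ^ (-((5 / 2 : ℝ) : ℂ)) * ((u : ℂ) + 2 * z) := by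
      rw [← p5, Complex.cpow_sub _ _ hne, Complex.cpow_one]; field_simp
    have p1 : ((u : ℂ) + 2 * z) ^ (-((1 / 2 : ℝ) : ℂ))
        = ((u : ℂ) + 2 * z) ^ (-((5 / 2 : ℝ) : ℂ)) * ((u : ℂ) + 2 * z) ^ 2 := by
      rw [show (-((5 / 2 : ℝ) : ℂ)) = -((1 / 2 : ℝ) : ℂ) - (2 : ℕ) by push_cast; ring,
        Complex.cpow_sub _ _ hne, Complex.cpow_natCast]
      field_simp
    simp only [Pi.sub_apply, laplaceIntegrand, gammaWeight]
    rw [p5, p1, p3, hu1]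
    push_cast
    ring
  · have hexp : Tendsto (fun u : ℝ => Real.exp (-u) * u ^ (1 / 2 : ℝ) * r ^ (-(3 / 2 : ℝ)))
        atTop (𝓝 (0 * r ^ (-(3 / 2 : ℝ)))) := by
      refine Tendsto.mul_const _ ?_
      have := tendsto_rpow_mul_exp_neg_mul_atTop_nhds_zero (1 / 2) 1 one_pos
      simpa [mul_comm] using this
    rw [zero_mul] at hexp
    refine squeeze_zero_norm' ?_ hexp
    filter_upwards [eventually_ge_atTop 0] with u hu
    rw [norm_mul, Complex.norm_real, Real.norm_of_nonneg (by positivity), ← Complex.ofReal_neg,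
      Complex.norm_cpow_real]
    exact mul_le_mul_of_nonneg_left
      (Real.rpow_le_rpow_of_nonpos hr (hlow u hu) (by norm_num)) (by positivity)

/-- The decaying solution `e⁻ᶻ F(z)` of the modified Bessel equation. -/
def laplaceK (z : ℂ) : ℂ := Complex.exp (-z) * laplaceIntegral (1 / 2) z

/-- `z` times the derivative of `laplaceK`. -/
def laplaceKTheta (z : ℂ) : ℂ :=
  z * (Complex.exp (-z) * (-laplaceIntegral (3 / 2) z - laplaceIntegral (1 / 2) z))

lemma hasDerivAt_laplaceIntegral_half {z : ℂ} (hz : z ∈ Complex.slitPlane) :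
    HasDerivAt (laplaceIntegral (1 / 2)) (-laplaceIntegral (3 / 2) z) z := by
  refine (hasDerivAt_laplaceIntegral (by norm_num) hz).congr_deriv ?_
  rw [show (1 / 2 + 1 : ℝ) = 3 / 2 by norm_num]
  push_cast
  ring

lemma hasDerivAt_laplaceK {z : ℂ} (hz : z ∈ Complex.slitPlane) :
    HasDerivAt laplaceK (laplaceKTheta z / z) z := by
  refine ((hasDerivAt_neg z).cexp.mul (hasDerivAt_laplaceIntegral_half hz)).congr_deriv ?_
  rw [laplaceKTheta, mul_div_cancel_left₀ _ (Complex.slitPlane_ne_zero hz)]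
  ring

lemma hasDerivAt_laplaceKTheta {z : ℂ} (hz : z ∈ Complex.slitPlane) :
    HasDerivAt laplaceKTheta (z * laplaceK z) z := by
  have h3 : HasDerivAt (laplaceIntegral (3 / 2)) (-3 * laplaceIntegral (5 / 2) z) z := by
    refine (hasDerivAt_laplaceIntegral (by norm_num) hz).congr_deriv ?_
    rw [show (3 / 2 + 1 : ℝ) = 5 / 2 by norm_num]
    push_cast
    ring
  refine ((hasDerivAt_id z).mul ((hasDerivAt_neg z).cexp.mul
    (h3.neg.sub (hasDerivAt_laplaceIntegral_half hz)))).congr_deriv ?_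
  simp only [laplaceK, id, Pi.mul_apply, Pi.sub_apply, Pi.neg_apply]
  linear_combination Complex.exp (-z) * laplaceIntegral_ode hz

/-! ### Uniqueness for the modified Bessel equation. -/

/-- For a solution of `x (x g')' = x² g` that tends to `0` at `0`, the quantity `v = x g'` is
`O(x²)`. -/
lemma abs_flux_le {g v : ℝ → ℝ} {b M : ℝ} (hg : ∀ x > 0, HasDerivAt g (v x / x) x)
    (hv : ∀ x > 0, HasDerivAt v (x * g x) x) (h0 : Tendsto g (𝓝[>] 0) (𝓝 0))
    (hM : ∀ x ∈ Ioc 0 b, |g x| ≤ M) {x : ℝ} (hx : x ∈ Ioc 0 b) : |v x| ≤ M * x ^ 2 := by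
  by_contra! hlt
  set η := |v x| - M * x ^ 2 with hη
  have hη0 : 0 < η := by linarith
  have hM0 : 0 ≤ M := (abs_nonneg _).trans (hM x hx)
  -- As `|v'| ≤ x M` on `(0, x]`, a violation at `x` keeps `|v|` above `η` down to `0`. Then `g`
  -- varies like `η log t`, and `g t - g (t / 2)` cannot tend to `0`.
  have hlow : ∀ t ∈ Ioc 0 x, η ≤ |v t| := by
    intro t ht
    have h1 : ‖v x - v t‖ ≤ (x * M) * ‖x - t‖ := by
      refine (convex_Ioc 0 x).norm_image_sub_le_of_norm_hasDerivWithin_le (f' := fun y => y * g y)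
        (fun y hy => (hv y hy.1).hasDerivWithinAt) (fun y hy => ?_) ht ⟨hx.1, le_rfl⟩
      rw [norm_mul, Real.norm_of_nonneg hy.1.le]
      exact mul_le_mul hy.2 (hM y ⟨hy.1, hy.2.trans hx.2⟩) (norm_nonneg _) hx.1.le
    rw [Real.norm_eq_abs, Real.norm_of_nonneg (by linarith [ht.2])] at h1
    have h2 : x * M * (x - t) ≤ M * x ^ 2 := by
      nlinarith [mul_nonneg (mul_nonneg hx.1.le hM0) ht.1.le]
    have h3 := abs_sub_abs_le_abs_sub (v x) (v t)
    linarith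
  have hdiff : ∀ t ∈ Ioc 0 x, η / 2 ≤ |g t - g (t / 2)| := by
    intro t ht
    have ht0 := ht.1
    obtain ⟨ξ, hξ, he⟩ := exists_hasDerivAt_eq_slope g (fun y => v y / y) (a := t / 2) (b := t)
      (by linarith) (fun y hy => (hg y (by linarith [hy.1])).continuousAt.continuousWithinAt)
      (fun y hy => hg y (by linarith [hy.1]))
    have hξ0 : 0 < ξ := by linarith [hξ.1]
    have h1 : g t - g (t / 2) = v ξ * (t / 2 / ξ) := by
      have : t - t / 2 = t / 2 := by ring
      rw [this] at he
      field_simp at he ⊢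
      linarith
    rw [h1, abs_mul, abs_of_pos (show 0 < t / 2 / ξ by positivity)]
    have h2 : 1 / 2 ≤ t / 2 / ξ := by
      rw [le_div_iff₀ hξ0]; linarith [hξ.2]
    nlinarith [hlow ξ ⟨hξ0, hξ.2.le.trans ht.2⟩]
  have hhalf : Tendsto (fun t : ℝ => t / 2) (𝓝[>] 0) (𝓝[>] 0) := by
    refine tendsto_nhdsWithin_iff.2 ⟨?_, ?_⟩
    · refine tendsto_nhdsWithin_of_tendsto_nhds ?_
      simpa using (continuous_id.div_const (2 : ℝ)).tendsto 0
    · filter_upwards [self_mem_nhdsWithin] with t ht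
      exact half_pos (mem_Ioi.1 ht)
  have hlim : Tendsto (fun t => |g t - g (t / 2)|) (𝓝[>] 0) (𝓝 |0 - 0|) :=
    (h0.sub (h0.comp hhalf)).abs
  have h := ge_of_tendsto hlim (b := η / 2) (by
    filter_upwards [Ioc_mem_nhdsGT hx.1] with t ht using hdiff t ht)
  simp at h
  linarith

/-- A solution of the modified Bessel equation `x (x g')' = x² g` that tends to `0` at `0` vanishes
near `0`. -/
lemma eventually_eq_zero_of_tendsto_zero {g v : ℝ → ℝ} (hg : ∀ x > 0, HasDerivAt g (v x / x) x)
    (hv : ∀ x > 0, HasDerivAt v (x * g x) x) (h0 : Tendsto g (𝓝[>] 0) (𝓝 0)) :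
    ∀ᶠ x in 𝓝[>] 0, g x = 0 := by
  have h1 : ∀ᶠ x in 𝓝[>] (0 : ℝ), |g x| ≤ 1 := by
    have := h0.abs
    rw [abs_zero] at this
    exact this.eventually_le_const one_pos
  obtain ⟨b, hb, hbs⟩ := mem_nhdsGT_iff_exists_Ioc_subset.1
    (inter_mem h1 (Ioc_mem_nhdsGT (show (0 : ℝ) < 1 / 2 by norm_num)))
  have hb0 : 0 < b := hb
  have hbhalf : b ≤ 1 / 2 := (hbs ⟨hb0, le_rfl⟩).2.2
  -- The flux bound gives `|g'(t)| ≤ M t ≤ M b`, so `g` varies by at most `M b² ≤ M / 4` on `(0,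
  -- b]`; letting `y → 0` improves the bound `M` to `M / 4`.
  have step : ∀ M : ℝ, (∀ x ∈ Ioc 0 b, |g x| ≤ M) → ∀ x ∈ Ioc 0 b, |g x| ≤ M / 4 := by
    intro M hM x hx
    have hM0 : 0 ≤ M := (abs_nonneg _).trans (hM x hx)
    have hbd : ∀ y ∈ Ioc 0 x, |g x - g y| ≤ M / 4 := by
      intro y hy
      have h2 : ‖g x - g y‖ ≤ (M * b) * ‖x - y‖ := by
        refine (convex_Ioc 0 x).norm_image_sub_le_of_norm_hasDerivWithin_le
          (f' := fun y => v y / y)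
          (fun y hy => (hg y hy.1).hasDerivWithinAt) (fun t ht => ?_) hy ⟨hx.1, le_rfl⟩
        have htb : t ≤ b := ht.2.trans hx.2
        have := abs_flux_le hg hv h0 hM ⟨ht.1, htb⟩
        rw [norm_div, Real.norm_of_nonneg ht.1.le, div_le_iff₀ ht.1, Real.norm_eq_abs]
        have h5 : M * t * t ≤ M * b * t := by
          have := ht.1.le
          gcongr
        nlinarith
      rw [Real.norm_eq_abs, Real.norm_of_nonneg (by linarith [hy.2])] at h2
      refine h2.trans ?_
      have h3 : x - y ≤ 1 / 2 := by linarith [hy.1, hx.2]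
      have h4 : M * b ≤ M * (1 / 2) := by gcongr
      have h5 : 0 ≤ x - y := by linarith [hy.2]
      nlinarith [mul_le_mul h4 h3 h5 (by positivity)]
    have hlim : Tendsto (fun y => |g x - g y|) (𝓝[>] 0) (𝓝 |g x - 0|) :=
      (tendsto_const_nhds.sub h0).abs
    rw [sub_zero] at hlim
    exact le_of_tendsto hlim (by filter_upwards [Ioc_mem_nhdsGT hx.1] with y hy using hbd y hy)
  have hpow : ∀ n : ℕ, ∀ x ∈ Ioc 0 b, |g x| ≤ (1 / 4 : ℝ) ^ n := by
    intro n
    induction n with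
    | zero => intro x hx; simpa using (hbs hx).1
    | succ n ih =>
      intro x hx
      rw [pow_succ, mul_one_div]
      exact step _ ih x hx
  filter_upwards [Ioc_mem_nhdsGT hb0] with x hx
  have hlim := tendsto_pow_atTop_nhds_zero_of_lt_one (r := (1 / 4 : ℝ)) (by norm_num) (by norm_num)
  exact abs_eq_zero.1 (le_antisymm (ge_of_tendsto' hlim fun n => hpow n x hx) (abs_nonneg _))

/-- The equation has real coefficients on the positive axis, so the real part of a solution is again
a solution. -/
lemma re_eventually_eq_zero {D V : ℂ → ℂ}
    (hD : ∀ z ∈ Complex.slitPlane, HasDerivAt D (V z / z) z)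
    (hV : ∀ z ∈ Complex.slitPlane, HasDerivAt V (z * D z) z)
    (h0 : Tendsto (fun x : ℝ => D x) (𝓝[>] 0) (𝓝 0)) :
    ∀ᶠ x : ℝ in 𝓝[>] 0, (D x).re = 0 := by
  refine eventually_eq_zero_of_tendsto_zero (v := fun x : ℝ => (V x).re) (fun x hx => ?_)
    (fun x hx => ?_) ?_
  · refine (hD x (Complex.ofReal_mem_slitPlane.2 hx)).real_of_complex.congr_deriv ?_
    rw [Complex.div_ofReal_re]
  · refine (hV x (Complex.ofReal_mem_slitPlane.2 hx)).real_of_complex.congr_deriv ?_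
    rw [Complex.re_ofReal_mul]
  · exact (Complex.continuous_re.tendsto 0).comp h0

/-- A solution of the modified Bessel equation of order zero on the slit plane that tends to `0`
along the positive reals at the origin vanishes. -/
lemma eq_zero_of_bessel_equation {D V : ℂ → ℂ}
    (hD : ∀ z ∈ Complex.slitPlane, HasDerivAt D (V z / z) z)
    (hV : ∀ z ∈ Complex.slitPlane, HasDerivAt V (z * D z) z)
    (h0 : Tendsto (fun x : ℝ => D x) (𝓝[>] 0) (𝓝 0)) {z : ℂ} (hz : z ∈ Complex.slitPlane) :
    D z = 0 := by
  have hre := re_eventually_eq_zero hD hV h0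
  -- Multiplication by `I` turns the imaginary part into a real part, up to sign.
  have him := re_eventually_eq_zero (D := fun z => Complex.I * D z) (V := fun z => Complex.I * V z)
    (fun z hz => ((hD z hz).const_mul Complex.I).congr_deriv (by ring))
    (fun z hz => ((hV z hz).const_mul Complex.I).congr_deriv (by ring))
    (by simpa using h0.const_mul Complex.I)
  obtain ⟨b, hb, hbs⟩ := mem_nhdsGT_iff_exists_Ioc_subset.1 (inter_mem hre him)
  have hb0 : (0 : ℝ) < b := hb
  have hzero : ∀ x ∈ Ioc 0 b, D (x : ℂ) = 0 := by
    intro x hx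
    have h := hbs hx
    refine Complex.ext h.1 ?_
    have h2 : (Complex.I * D x).re = 0 := h.2
    simpa using h2
  have hDa : AnalyticOnNhd ℂ D Complex.slitPlane := DifferentiableOn.analyticOnNhd
    (fun z hz => (hD z hz).differentiableAt.differentiableWithinAt) Complex.isOpen_slitPlane
  have hpre : IsPreconnected Complex.slitPlane :=
    (Complex.starConvex_one_slitPlane.isPathConnected
      Complex.one_mem_slitPlane).isConnected.isPreconnected
  -- The zeros fill `(0, b]`; they must accumulate at a point of the domain, and `b / 2` is one
  -- while `0` is not.
  refine hDa.eqOn_zero_of_preconnected_of_frequently_eq_zero hpre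
    (z₀ := ((b / 2 : ℝ) : ℂ)) (Complex.ofReal_mem_slitPlane.2 (by positivity)) ?_ hz
  have ht : Tendsto (fun x : ℝ => (x : ℂ)) (𝓝[>] (b / 2)) (𝓝[≠] ((b / 2 : ℝ) : ℂ)) := by
    refine tendsto_nhdsWithin_iff.2 ⟨?_, ?_⟩
    · exact tendsto_nhdsWithin_of_tendsto_nhds (Complex.continuous_ofReal.tendsto _)
    · filter_upwards [self_mem_nhdsWithin] with x hx
      exact fun h => (ne_of_gt (mem_Ioi.1 hx)) (Complex.ofReal_injective h)
  refine ht.frequently (Eventually.frequently ?_)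
  filter_upwards [Ioc_mem_nhdsGT (show b / 2 < b by linarith)] with x hx
  exact hzero x ⟨by linarith [hx.1], hx.2⟩

/-! ### Matching the behaviour of both solutions at the origin. -/

/-- The singular part `log (x/2) + γ` of `-K₀` on the positive reals. -/
def logPart (x : ℝ) : ℝ := Real.log (x / 2) + Real.eulerMascheroniConstant

lemma ofReal_logPart {x : ℝ} (hx : 0 < x) :
    (logPart x : ℂ) = Complex.log ((x : ℂ) / 2) + (Real.eulerMascheroniConstant : ℂ) := by
  rw [logPart, Complex.ofReal_add, Complex.ofReal_log (by positivity)]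
  push_cast
  rfl

lemma tendsto_mul_logPart : Tendsto (fun x : ℝ => x * logPart x) (𝓝[>] 0) (𝓝 0) := by
  have h1 := tendsto_log_mul_rpow_nhdsGT_zero one_pos
  have h2 : Tendsto (fun x : ℝ => x * (Real.eulerMascheroniConstant - Real.log 2)) (𝓝[>] 0)
      (𝓝 (0 * (Real.eulerMascheroniConstant - Real.log 2))) :=
    (tendsto_nhdsWithin_of_tendsto_nhds tendsto_id).mul_const _
  have h3 := h1.add h2
  rw [zero_mul, add_zero] at h3
  refine h3.congr' ?_
  filter_upwards [self_mem_nhdsWithin] with x hx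
  have hx : 0 < x := hx
  rw [logPart, Real.log_div hx.ne' two_ne_zero, Real.rpow_one]
  ring

/-- A differentiable `g` with `g 0 = 0` is `x` times its slope, which is continuous at `0`, and `x
log x → 0`. -/
lemma tendsto_mul_logPart_of_zero {g : ℂ → ℂ} (hg : DifferentiableAt ℂ g 0) (h0 : g 0 = 0) :
    Tendsto (fun x : ℝ => g x * (logPart x : ℂ)) (𝓝[>] 0) (𝓝 0) := by
  have h1 : Tendsto (fun x : ℝ => dslope g 0 (x : ℂ)) (𝓝[>] 0) (𝓝 (dslope g 0 0)) := by
    have hc : ContinuousAt (dslope g 0) 0 := continuousAt_dslope_same.2 hg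
    refine tendsto_nhdsWithin_of_tendsto_nhds ?_
    have := hc.tendsto.comp (f := fun x : ℝ => (x : ℂ)) (x := 𝓝 0)
      (by simpa using Complex.continuous_ofReal.tendsto 0)
    exact this
  have h2 : Tendsto (fun x : ℝ => ((x * logPart x : ℝ) : ℂ)) (𝓝[>] 0) (𝓝 ((0 : ℝ) : ℂ)) :=
    (Complex.continuous_ofReal.tendsto 0).comp tendsto_mul_logPart
  have h3 := h1.mul h2
  rw [Complex.ofReal_zero, mul_zero] at h3
  refine h3.congr fun x => ?_
  have h4 := sub_smul_dslope g 0 (x : ℂ)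
  rw [h0, sub_zero, sub_zero, smul_eq_mul] at h4
  rw [← h4]
  push_cast
  ring

lemma evenSeries_zero (c : ℕ → ℂ) : evenSeries c 0 = c 0 := by
  rw [evenSeries, tsum_eq_single 0]
  · simp
  · intro k hk
    simp [hk]

lemma tendsto_besselK0_add_logPart :
    Tendsto (fun x : ℝ => besselK0 x + (logPart x : ℂ)) (𝓝[>] 0) (𝓝 0) := by
  have h1 := tendsto_mul_logPart_of_zero (g := fun z => evenSeries besselCoeff z - 1)
    ((differentiable_evenSeries entireCoeff_bessel).sub_const 1 0)
    (by simp [evenSeries_zero, besselCoeff])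
  have h2 : Tendsto (fun x : ℝ => evenSeries harmonicCoeff x) (𝓝[>] 0) (𝓝 0) := by
    have := ((differentiable_evenSeries entireCoeff_harmonic).continuous.comp
      Complex.continuous_ofReal).tendsto 0
    simp only [Function.comp_def, Complex.ofReal_zero, evenSeries_zero, harmonicCoeff,
      harmonic_zero, Rat.cast_zero, zero_mul] at this
    exact tendsto_nhdsWithin_of_tendsto_nhds this
  have h3 := h2.sub h1
  rw [sub_zero] at h3
  refine h3.congr' ?_
  filter_upwards [self_mem_nhdsWithin] with x hx
  rw [besselK0_eq, ofReal_logPart hx]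
  ring

/-- The primitive `2 log (√u + √(u + 2x))` of `1 / (√u √(u + 2x))`. -/
def logSqrt (x u : ℝ) : ℝ := 2 * Real.log (√u + √(u + 2 * x))

/-- An integrable majorant of `e⁻ᵘ |logSqrt x u|`. -/
def logMajorant (u : ℝ) : ℝ :=
  2 * (Real.exp (-u) * u ^ ((1 / 2 : ℝ) - 1)) + 5 * (Real.exp (-u) * u ^ ((2 : ℝ) - 1))
    + 4 * (Real.exp (-u) * u ^ ((1 : ℝ) - 1))

lemma integrableOn_logMajorant : IntegrableOn logMajorant (Ioi 0) :=
  (((Real.GammaIntegral_convergent one_half_pos).const_mul 2).add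
    ((Real.GammaIntegral_convergent two_pos).const_mul 5)).add
    ((Real.GammaIntegral_convergent one_pos).const_mul 4)

lemma tendsto_logMajorant : Tendsto logMajorant atTop (𝓝 0) := by
  have h : ∀ s : ℝ, Tendsto (fun u : ℝ => Real.exp (-u) * u ^ s) atTop (𝓝 0) := by
    intro s
    simpa [mul_comm] using tendsto_rpow_mul_exp_neg_mul_atTop_nhds_zero s 1 one_pos
  simpa using! (((h _).const_mul 2).add ((h _).const_mul 5)).add ((h _).const_mul 4)

lemma neg_log_le {u : ℝ} (hu : 0 < u) : -Real.log u ≤ 2 * u ^ ((1 / 2 : ℝ) - 1) := by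
  have h := Real.log_le_self (x := u ^ ((1 / 2 : ℝ) - 1)) (by positivity)
  rw [Real.log_rpow hu] at h
  linarith

lemma logSqrt_eq (x u : ℝ) :
    logSqrt x u = Real.log ((√u + √(u + 2 * x)) ^ 2) := by
  rw [Real.log_pow, logSqrt]
  norm_num

lemma abs_exp_mul_logSqrt_le {x u : ℝ} (hx : 0 ≤ x) (hx1 : x ≤ 1 / 2) (hu : 0 < u) :
    |Real.exp (-u) * logSqrt x u| ≤ logMajorant u := by
  have s1 : 0 < √u := Real.sqrt_pos.2 hu
  have s2 : 0 ≤ √(u + 2 * x) := Real.sqrt_nonneg _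
  have q1 := Real.sq_sqrt hu.le
  have q2 := Real.sq_sqrt (show 0 ≤ u + 2 * x by linarith)
  have lo : -(2 * u ^ ((1 / 2 : ℝ) - 1)) ≤ logSqrt x u := by
    have h1 : Real.log u ≤ logSqrt x u := by
      rw [logSqrt_eq]
      exact Real.log_le_log hu (by nlinarith)
    linarith [neg_log_le hu]
  have hi : logSqrt x u ≤ 5 * u + 4 := by
    rw [logSqrt_eq]
    refine (Real.log_le_self (by positivity)).trans ?_
    -- The square of the sum is at most `2 (u + (u + 2x)) ≤ 4u + 2`.
    nlinarith [sq_nonneg (√u - √(u + 2 * x))]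
  have habs : |logSqrt x u| ≤ 2 * u ^ ((1 / 2 : ℝ) - 1) + (5 * u + 4) := by
    have : 0 ≤ u ^ ((1 / 2 : ℝ) - 1) := by positivity
    exact abs_le.2 ⟨by linarith, by linarith⟩
  rw [abs_mul, abs_of_pos (Real.exp_pos _)]
  refine (mul_le_mul_of_nonneg_left habs (Real.exp_pos _).le).trans_eq ?_
  rw [logMajorant, show (2 : ℝ) - 1 = 1 by norm_num, sub_self, Real.rpow_one, Real.rpow_zero]
  ring

lemma measurable_exp_mul_logSqrt (x : ℝ) : Measurable fun u => Real.exp (-u) * logSqrt x u := by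
  unfold logSqrt
  fun_prop

lemma integrableOn_exp_mul_logSqrt {x : ℝ} (hx : 0 ≤ x) (hx1 : x ≤ 1 / 2) :
    IntegrableOn (fun u => Real.exp (-u) * logSqrt x u) (Ioi 0) := by
  refine Integrable.mono' integrableOn_logMajorant
    (measurable_exp_mul_logSqrt x).aestronglyMeasurable ?_
  filter_upwards [ae_restrict_mem measurableSet_Ioi] with u hu
  exact abs_exp_mul_logSqrt_le hx hx1 hu

lemma hasDerivAt_logSqrt {x u : ℝ} (hx : 0 < x) (hu : 0 < u) :
    HasDerivAt (logSqrt x) (u ^ ((1 / 2 : ℝ) - 1) * (u + 2 * x) ^ (-(1 / 2 : ℝ))) u := by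
  have hu2 : 0 < u + 2 * x := by positivity
  have s1 : 0 < √u := Real.sqrt_pos.2 hu
  have s2 : 0 < √(u + 2 * x) := Real.sqrt_pos.2 hu2
  have h1 := Real.hasDerivAt_sqrt hu.ne'
  have h2 : HasDerivAt (fun u => √(u + 2 * x)) (1 / (2 * √(u + 2 * x))) u :=
    ((hasDerivAt_id u).add_const (2 * x)).sqrt hu2.ne'
  have h12 : √u + √(u + 2 * x) ≠ 0 := by positivity
  refine (((h1.fun_add h2).log h12).const_mul 2).congr_deriv ?_
  rw [show (1 / 2 : ℝ) - 1 = -(1 / 2) by norm_num, Real.rpow_neg hu.le, Real.rpow_neg hu2.le,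
    ← Real.sqrt_eq_rpow, ← Real.sqrt_eq_rpow]
  field_simp
  ring

lemma laplaceIntegrand_ofReal {x u : ℝ} (hx : 0 < x) (hu : 0 < u) :
    laplaceIntegrand (1 / 2) x u
      = ((gammaWeight u * (u + 2 * x) ^ (-(1 / 2 : ℝ)) : ℝ) : ℂ) := by
  rw [laplaceIntegrand, Complex.ofReal_mul, Complex.ofReal_cpow (by positivity)]
  push_cast
  rfl

/-- Integration by parts with the primitive `logSqrt x`: the boundary term at `u = 0` carries the
whole logarithmic singularity, and the remaining integral converges as `x → 0⁺`. -/
lemma laplaceIntegral_half_ofReal {x : ℝ} (hx : 0 < x) (hx1 : x ≤ 1 / 2) :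
    laplaceIntegral (1 / 2) x
      = (((∫ u in Ioi (0 : ℝ), Real.exp (-u) * logSqrt x u) - Real.log (2 * x) : ℝ) : ℂ) := by
  have hint : IntegrableOn (fun u => gammaWeight u * (u + 2 * x) ^ (-(1 / 2 : ℝ))) (Ioi 0) := by
    have h := (integrableOn_laplaceIntegrand (s := 1 / 2) (by norm_num)
      (Complex.ofReal_mem_slitPlane.2 hx)).re
    refine h.congr ?_
    filter_upwards [ae_restrict_mem measurableSet_Ioi] with u hu
    rw [laplaceIntegrand_ofReal hx hu]
    simp
  have e1 : laplaceIntegral (1 / 2) x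
      = ((∫ u in Ioi (0 : ℝ), gammaWeight u * (u + 2 * x) ^ (-(1 / 2 : ℝ)) : ℝ) : ℂ) := by
    rw [laplaceIntegral, ← integral_complex_ofReal]
    exact setIntegral_congr_fun measurableSet_Ioi fun u hu => laplaceIntegrand_ofReal hx hu
  have hL := integrableOn_exp_mul_logSqrt hx.le hx1
  have key := integral_Ioi_of_hasDerivAt_of_tendsto (a := 0) (m := 0)
    (f := fun u : ℝ => Real.exp (-u) * logSqrt x u) ?_ ?_ (hint.sub hL) ?_
  · rw [integral_sub' hint hL] at key
    rw [e1]
    congr 1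
    have h0 : logSqrt x 0 = Real.log (2 * x) := by
      rw [logSqrt, Real.sqrt_zero, zero_add, zero_add, Real.log_sqrt (by positivity)]
      ring
    rw [h0, neg_zero, Real.exp_zero] at key
    linarith
  · refine ContinuousAt.continuousWithinAt ?_
    have : 0 < √0 + √(0 + 2 * x) := by
      rw [Real.sqrt_zero, zero_add, zero_add]; positivity
    unfold logSqrt
    refine ContinuousAt.mul (by fun_prop) (continuousAt_const.mul (ContinuousAt.log (by fun_prop)
      this.ne'))
  · intro u hu
    refine (((hasDerivAt_neg u).exp).mul (hasDerivAt_logSqrt hx hu)).congr_deriv ?_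
    simp only [Pi.sub_apply, gammaWeight]
    ring
  · refine squeeze_zero_norm' ?_ tendsto_logMajorant
    filter_upwards [eventually_gt_atTop 0] with u hu
    exact abs_exp_mul_logSqrt_le hx.le hx1 hu

/-- Both sides are `Γ'(1)`; the left one comes from differentiating Euler's integral. -/
lemma integral_exp_neg_mul_log :
    ∫ u in Ioi (0 : ℝ), Real.exp (-u) * Real.log u = -Real.eulerMascheroniConstant := by
  have h1 := Complex.hasDerivAt_GammaIntegral (s := 1) (by simp)
  have h2 : HasDerivAt Complex.GammaIntegral (-(Real.eulerMascheroniConstant : ℂ)) 1 := by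
    refine Complex.hasDerivAt_Gamma_one.congr_of_eventuallyEq ?_
    have : ∀ᶠ s : ℂ in 𝓝 1, 0 < s.re :=
      (Complex.continuous_re.isOpen_preimage _ isOpen_Ioi).mem_nhds (by simp)
    filter_upwards [this] with s hs
    exact (Complex.Gamma_eq_integral hs).symm
  have h3 := h1.unique h2
  have h4 : ((∫ u in Ioi (0 : ℝ), Real.exp (-u) * Real.log u : ℝ) : ℂ)
      = ((-Real.eulerMascheroniConstant : ℝ) : ℂ) := by
    rw [← integral_complex_ofReal, Complex.ofReal_neg, ← h3]
    refine integral_congr_ae (Eventually.of_forall fun u => ?_)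
    simp [mul_comm]
  exact Complex.ofReal_injective h4

lemma integral_exp_mul_logSqrt_zero :
    ∫ u in Ioi (0 : ℝ), Real.exp (-u) * logSqrt 0 u
      = 2 * Real.log 2 - Real.eulerMascheroniConstant := by
  have hexp : IntegrableOn (fun u : ℝ => Real.exp (-u) * (2 * Real.log 2)) (Ioi 0) :=
    (integrableOn_exp_neg_Ioi 0).mul_const _
  have e : ∀ u ∈ Ioi (0 : ℝ), Real.exp (-u) * logSqrt 0 u - Real.exp (-u) * (2 * Real.log 2)
      = Real.exp (-u) * Real.log u := by
    intro u hu
    have hu : 0 < u := hu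
    have s1 : √u ≠ 0 := (Real.sqrt_pos.2 hu).ne'
    rw [logSqrt, mul_zero, add_zero, ← two_mul, Real.log_mul two_ne_zero s1, Real.log_sqrt hu.le]
    ring
  have h := setIntegral_congr_fun (μ := volume) measurableSet_Ioi e
  rw [integral_sub (integrableOn_exp_mul_logSqrt le_rfl (by norm_num)) hexp,
    integral_exp_neg_mul_log, integral_mul_const, integral_exp_neg_Ioi_zero] at h
  linarith

lemma tendsto_laplaceIntegral_add_logPart :
    Tendsto (fun x : ℝ => laplaceIntegral (1 / 2) x + (logPart x : ℂ)) (𝓝[>] 0) (𝓝 0) := by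
  have hsmall : ∀ᶠ x : ℝ in 𝓝[>] 0, x ∈ Ioc 0 (1 / 2) := Ioc_mem_nhdsGT (by norm_num)
  have h1 : Tendsto (fun x : ℝ => ∫ u in Ioi (0 : ℝ), Real.exp (-u) * logSqrt x u) (𝓝[>] 0)
      (𝓝 (∫ u in Ioi (0 : ℝ), Real.exp (-u) * logSqrt 0 u)) := by
    refine tendsto_integral_filter_of_dominated_convergence logMajorant
      (Eventually.of_forall fun x => (measurable_exp_mul_logSqrt x).aestronglyMeasurable) ?_
      integrableOn_logMajorant ?_
    · filter_upwards [hsmall] with x hx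
      filter_upwards [ae_restrict_mem measurableSet_Ioi] with u hu
      exact abs_exp_mul_logSqrt_le hx.1.le hx.2 hu
    · filter_upwards [ae_restrict_mem measurableSet_Ioi] with u hu
      have s1 : 0 < √u := Real.sqrt_pos.2 hu
      have hc : ContinuousAt (fun x => Real.exp (-u) * logSqrt x u) 0 := by
        unfold logSqrt
        refine continuousAt_const.mul (continuousAt_const.mul (ContinuousAt.log (by fun_prop) ?_))
        positivity
      exact tendsto_nhdsWithin_of_tendsto_nhds hc.tendsto
  rw [integral_exp_mul_logSqrt_zero] at h1
  have h2 := h1.sub_const (2 * Real.log 2 - Real.eulerMascheroniConstant)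
  rw [sub_self] at h2
  have h3 := (Complex.continuous_ofReal.tendsto 0).comp h2
  rw [Complex.ofReal_zero] at h3
  refine h3.congr' ?_
  filter_upwards [hsmall] with x hx
  rw [laplaceIntegral_half_ofReal hx.1 hx.2, ← Complex.ofReal_add, Function.comp_apply, logPart,
    Real.log_mul two_ne_zero hx.1.ne', Real.log_div hx.1.ne' two_ne_zero]
  congr 1
  ring

/-- The integral representation `K₀(z) = e⁻ᶻ ∫₀^∞ e⁻ᵘ u^(-1/2) (u + 2z)^(-1/2) du`. -/
theorem besselK0_eq_laplaceK {z : ℂ} (hz : z ∈ Complex.slitPlane) : besselK0 z = laplaceK z := by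
  have hlim : Tendsto (fun x : ℝ => laplaceK x - besselK0 x) (𝓝[>] 0) (𝓝 0) := by
    have hexp : Tendsto (fun x : ℝ => Complex.exp (-(x : ℂ))) (𝓝[>] 0) (𝓝 1) := by
      have : Continuous fun x : ℝ => Complex.exp (-(x : ℂ)) := by fun_prop
      simpa using tendsto_nhdsWithin_of_tendsto_nhds (s := Ioi 0) (this.tendsto 0)
    -- With `L = logPart`, the difference is `e⁻ˣ (F + L) - (K₀ + L) - (e⁻ˣ - 1) L`, and each term
    -- tends to `0`.
    have h1 := tendsto_mul_logPart_of_zero (g := fun z => Complex.exp (-z) - 1) (by fun_prop)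
      (by simp)
    have h2 := ((hexp.mul tendsto_laplaceIntegral_add_logPart).sub
      tendsto_besselK0_add_logPart).sub h1
    simp only [mul_zero, sub_zero] at h2
    refine h2.congr fun x => ?_
    rw [laplaceK]
    ring
  have h := eq_zero_of_bessel_equation (D := fun z => laplaceK z - besselK0 z)
    (V := fun z => laplaceKTheta z - besselK0Theta z)
    (fun z hz => ((hasDerivAt_laplaceK hz).sub (hasDerivAt_besselK0 hz)).congr_deriv (by ring))
    (fun z hz => ((hasDerivAt_laplaceKTheta hz).sub (hasDerivAt_besselK0Theta hz)).congr_deriv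
      (by ring)) hlim hz
  exact (sub_eq_zero.1 h).symm

/-! ### Geometry of the sector and of the damped root. -/

lemma mem_slitPlane_iff_abs_arg_lt {z : ℂ} (hz : z ≠ 0) :
    z ∈ Complex.slitPlane ↔ |Complex.arg z| < Real.pi := by
  rw [Complex.mem_slitPlane_iff_arg, abs_lt]
  constructor
  · rintro ⟨h, -⟩
    exact ⟨Complex.neg_pi_lt_arg z, lt_of_le_of_ne (Complex.arg_le_pi z) h⟩
  · rintro ⟨-, h⟩
    exact ⟨h.ne, hz⟩

lemma sector_subset_slitPlane {δ : ℝ} (hδ : 0 ≤ δ) : sector δ ⊆ Complex.slitPlane :=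
  fun _ hz => (mem_slitPlane_iff_abs_arg_lt hz.1).2 (by linarith [hz.2])

lemma mul_ofReal_mem_sector {δ r : ℝ} (hr : 0 < r) {z : ℂ} (hz : z ∈ sector δ) :
    z * (r : ℂ) ∈ sector δ := by
  refine ⟨mul_ne_zero hz.1 (Complex.ofReal_ne_zero.2 hr.ne'), ?_⟩
  rw [Complex.arg_mul_real hr]
  exact hz.2

/-- The distance of a point of the sector to the negative real axis. -/
lemma sin_mul_norm_le_norm_add {δ : ℝ} (hδ : δ ∈ Ioo 0 (Real.pi / 2)) {z : ℂ} (hz : z ∈ sector δ)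
    {u : ℝ} (hu : 0 ≤ u) : Real.sin δ * ‖z‖ ≤ ‖(u : ℂ) + z‖ := by
  have hre : -Real.cos δ * ‖z‖ ≤ z.re := by
    have h1 : -Real.cos δ ≤ Real.cos (Complex.arg z) := by
      rw [← Real.cos_pi_sub, ← Real.cos_abs (Complex.arg z)]
      exact Real.cos_le_cos_of_nonneg_of_le_pi (abs_nonneg _) (by linarith [hδ.1]) hz.2.le
    rw [Complex.cos_arg hz.1, le_div_iff₀ (norm_pos_iff.2 hz.1)] at h1
    exact h1
  refine le_of_sq_le_sq ?_ (norm_nonneg _)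
  have e1 : ‖(u : ℂ) + z‖ ^ 2 = u ^ 2 + 2 * u * z.re + ‖z‖ ^ 2 := by
    rw [Complex.sq_norm, Complex.sq_norm, Complex.normSq_apply, Complex.normSq_apply]
    simp
    ring
  rw [e1, mul_pow, Real.sin_sq]
  -- Completing the square: the difference of the two sides is at least `(u - |z| cos δ)²`.
  nlinarith [sq_nonneg (u - ‖z‖ * Real.cos δ), mul_le_mul_of_nonneg_left hre hu]

/-- In terms of cosines: a shift to the right does not decrease `cos (arg z)`. With `z = x + iy`,
the squares of the two sides differ by `y² α (2x + α)`; the case split handles the signs. -/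
lemma re_mul_norm_add_le {α : ℝ} (hα : 0 ≤ α) (z : ℂ) :
    z.re * ‖z + (α : ℂ)‖ ≤ (z.re + α) * ‖z‖ := by
  have hA : ‖z‖ ^ 2 = z.re ^ 2 + z.im ^ 2 := by
    rw [Complex.sq_norm, Complex.normSq_apply]; ring
  have hB : ‖z + (α : ℂ)‖ ^ 2 = (z.re + α) ^ 2 + z.im ^ 2 := by
    rw [Complex.sq_norm, Complex.normSq_apply]; simp; ring
  have nA := norm_nonneg z
  have nB := norm_nonneg (z + (α : ℂ))
  set A := ‖z‖
  set B := ‖z + (α : ℂ)‖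
  rcases le_or_gt 0 z.re with h | h
  · refine le_of_sq_le_sq ?_ (by positivity)
    rw [mul_pow, mul_pow, hA, hB]
    nlinarith [mul_nonneg (sq_nonneg z.im) (mul_nonneg hα (by linarith : 0 ≤ 2 * z.re + α))]
  rcases le_or_gt 0 (z.re + α) with h' | h'
  · exact (mul_nonpos_of_nonpos_of_nonneg h.le nB).trans (by positivity)
  · have : -(z.re + α) * A ≤ -z.re * B := by
      refine le_of_sq_le_sq ?_ (mul_nonneg (by linarith) nB)
      rw [mul_pow, mul_pow, hA, hB]
      nlinarith [mul_nonneg (sq_nonneg z.im) (mul_nonneg hα (by linarith : 0 ≤ -(2 * z.re + α)))]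
    linarith

lemma add_ofReal_mem_slitPlane {α : ℝ} (hα : 0 ≤ α) {z : ℂ} (hz : z ∈ Complex.slitPlane) :
    z + (α : ℂ) ∈ Complex.slitPlane := by
  rw [Complex.mem_slitPlane_iff] at hz ⊢
  rcases hz with h | h
  · left; simp; linarith
  · right; simpa using h

lemma abs_arg_add_le {α : ℝ} (hα : 0 ≤ α) {z : ℂ} (hz : z ∈ Complex.slitPlane) :
    |Complex.arg (z + (α : ℂ))| ≤ |Complex.arg z| := by
  have hz0 := Complex.slitPlane_ne_zero hz
  have hz1 := Complex.slitPlane_ne_zero (add_ofReal_mem_slitPlane hα hz)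
  by_contra! h
  have h1 := Real.cos_lt_cos_of_nonneg_of_le_pi (abs_nonneg _) (Complex.abs_arg_le_pi _) h
  rw [Real.cos_abs, Real.cos_abs, Complex.cos_arg hz0, Complex.cos_arg hz1,
    div_lt_div_iff₀ (norm_pos_iff.2 hz1) (norm_pos_iff.2 hz0)] at h1
  have h2 := re_mul_norm_add_le hα z
  simp at h1
  linarith

lemma cpow_half_mul_self (z : ℂ) : z ^ (1 / 2 : ℂ) * z ^ (1 / 2 : ℂ) = z := by
  have h := Complex.cpow_nat_inv_pow z two_ne_zero
  rw [pow_two] at h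
  simpa using h

lemma dampedRoot_mul_self (α : ℝ) (z : ℂ) :
    dampedRoot α z * dampedRoot α z = z * (z + (α : ℂ)) := by
  rw [dampedRoot, mul_mul_mul_comm, cpow_half_mul_self, cpow_half_mul_self]

lemma dampedRoot_ne_zero {α : ℝ} (hα : 0 ≤ α) {z : ℂ} (hz : z ∈ Complex.slitPlane) :
    dampedRoot α z ≠ 0 := by
  intro h
  have h1 := dampedRoot_mul_self α z
  rw [h, zero_mul] at h1
  exact mul_ne_zero (Complex.slitPlane_ne_zero hz)
    (Complex.slitPlane_ne_zero (add_ofReal_mem_slitPlane hα hz)) h1.symm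

/-- The argument of the root is the mean of those of `z` and `z + α`, with no wrap-around since this
mean is below `π` in absolute value. -/
lemma abs_arg_dampedRoot_le {α : ℝ} (hα : 0 ≤ α) {z : ℂ} (hz : z ∈ Complex.slitPlane) :
    |Complex.arg (dampedRoot α z)| ≤ |Complex.arg z| := by
  have hz0 := Complex.slitPlane_ne_zero hz
  have hz1 := Complex.slitPlane_ne_zero (add_ofReal_mem_slitPlane hα hz)
  set ζ := Complex.log z * (1 / 2) + Complex.log (z + (α : ℂ)) * (1 / 2) with hζ
  have him : ζ.im = (Complex.arg z + Complex.arg (z + (α : ℂ))) / 2 := by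
    rw [hζ, Complex.add_im, show (1 / 2 : ℂ) = ((1 / 2 : ℝ) : ℂ) by push_cast; rfl,
      Complex.im_mul_ofReal, Complex.im_mul_ofReal, Complex.log_im, Complex.log_im]
    ring
  have hle : |ζ.im| ≤ |Complex.arg z| := by
    rw [him, abs_div, abs_two]
    have := abs_add_le (Complex.arg z) (Complex.arg (z + (α : ℂ)))
    linarith [abs_arg_add_le hα hz]
  have hpi := abs_lt.1 (hle.trans_lt ((mem_slitPlane_iff_abs_arg_lt hz0).1 hz))
  have hw : dampedRoot α z = Complex.exp ζ := by
    rw [dampedRoot, Complex.cpow_def_of_ne_zero hz0, Complex.cpow_def_of_ne_zero hz1,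
      ← Complex.exp_add]
  rw [hw, ← Complex.log_im, Complex.log_exp hpi.1 hpi.2.le]
  exact hle

lemma dampedRoot_mem_slitPlane {α : ℝ} (hα : 0 ≤ α) {z : ℂ} (hz : z ∈ Complex.slitPlane) :
    dampedRoot α z ∈ Complex.slitPlane :=
  (mem_slitPlane_iff_abs_arg_lt (dampedRoot_ne_zero hα hz)).2
    ((abs_arg_dampedRoot_le hα hz).trans_lt
      ((mem_slitPlane_iff_abs_arg_lt (Complex.slitPlane_ne_zero hz)).1 hz))

lemma dampedRoot_mem_sector {α δ : ℝ} (hα : 0 ≤ α) (hδ : 0 ≤ δ) {z : ℂ} (hz : z ∈ sector δ) :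
    dampedRoot α z ∈ sector δ :=
  ⟨dampedRoot_ne_zero hα (sector_subset_slitPlane hδ hz),
    (abs_arg_dampedRoot_le hα (sector_subset_slitPlane hδ hz)).trans_lt hz.2⟩

lemma re_cpow_half_pos {z : ℂ} (hz : z ∈ Complex.slitPlane) : 0 < (z ^ (1 / 2 : ℂ)).re := by
  have hz0 := Complex.slitPlane_ne_zero hz
  have h := abs_lt.1 ((mem_slitPlane_iff_abs_arg_lt hz0).1 hz)
  rw [Complex.cpow_def_of_ne_zero hz0, Complex.exp_re,
    show (1 / 2 : ℂ) = ((1 / 2 : ℝ) : ℂ) by push_cast; rfl, Complex.im_mul_ofReal, Complex.log_im]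
  exact mul_pos (Real.exp_pos _) (Real.cos_pos_of_mem_Ioo ⟨by linarith [h.1], by linarith [h.2]⟩)

/-- Two complex numbers in the right half plane whose squares have the same imaginary part satisfy
`|a| ≤ |b + a|`. -/
lemma norm_le_norm_add_of_im_sq_eq {a b : ℂ} (ha : 0 < a.re) (hb : 0 < b.re)
    (h : (a * a).im = (b * b).im) : ‖a‖ ≤ ‖b + a‖ := by
  simp only [Complex.mul_im] at h
  -- The imaginary parts have the same sign, so the real inner product of `a` and `b` is positive
  -- and adding `b` cannot shorten `a`.
  have him : 0 ≤ a.im * b.im := by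
    have : a.im * a.re = b.im * b.re := by linarith
    have h2 : 0 ≤ (a.im * b.im) * (a.re * b.re) := by
      have : (a.im * b.im) * (a.re * b.re) = (b.im * b.re) ^ 2 := by
        calc _ = (a.im * a.re) * (b.im * b.re) := by ring
          _ = _ := by rw [this]; ring
      rw [this]; positivity
    exact nonneg_of_mul_nonneg_left h2 (mul_pos ha hb)
  refine le_of_sq_le_sq ?_ (norm_nonneg _)
  rw [Complex.sq_norm, Complex.sq_norm, Complex.normSq_apply, Complex.normSq_apply, Complex.add_re,
    Complex.add_im]
  nlinarith [mul_pos ha hb, sq_nonneg b.re, sq_nonneg b.im]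

/-- With `a = √z` and `b = √(z + α)`, the difference is `a (b - a)`, while `(b - a)(b + a) = α` and
`|a| ≤ |b + a|`. -/
lemma norm_dampedRoot_sub_le {α : ℝ} (hα : 0 ≤ α) {z : ℂ} (hz : z ∈ Complex.slitPlane) :
    ‖dampedRoot α z - z‖ ≤ α := by
  have ha := re_cpow_half_pos hz
  have hb := re_cpow_half_pos (add_ofReal_mem_slitPlane hα hz)
  have haa := cpow_half_mul_self z
  have hbb := cpow_half_mul_self (z + (α : ℂ))
  have hdef : dampedRoot α z = z ^ (1 / 2 : ℂ) * (z + (α : ℂ)) ^ (1 / 2 : ℂ) := rfl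
  set a := z ^ (1 / 2 : ℂ)
  set b := (z + (α : ℂ)) ^ (1 / 2 : ℂ)
  have hle : ‖a‖ ≤ ‖b + a‖ := norm_le_norm_add_of_im_sq_eq ha hb (by rw [haa, hbb]; simp)
  have hprod : (b - a) * (b + a) = (α : ℂ) := by linear_combination hbb - haa
  have hnorm : ‖b - a‖ * ‖b + a‖ = α := by
    rw [← norm_mul, hprod, Complex.norm_real, Real.norm_of_nonneg hα]
  have e : dampedRoot α z - z = a * (b - a) := by rw [hdef]; linear_combination haa
  rw [e, norm_mul, mul_comm]
  exact (mul_le_mul_of_nonneg_left hle (norm_nonneg _)).trans_eq hnorm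

lemma sin_mul_norm_le_norm_dampedRoot {α δ : ℝ} (hα : 0 ≤ α) (hδ : δ ∈ Ioo 0 (Real.pi / 2)) {z : ℂ}
    (hz : z ∈ sector δ) : Real.sin δ * ‖z‖ ≤ ‖dampedRoot α z‖ := by
  have hsin : 0 ≤ Real.sin δ :=
    Real.sin_nonneg_of_nonneg_of_le_pi hδ.1.le (by linarith [hδ.2, Real.pi_pos])
  refine le_of_sq_le_sq ?_ (norm_nonneg _)
  have h1 : ‖dampedRoot α z‖ ^ 2 = ‖z‖ * ‖(α : ℂ) + z‖ := by
    rw [pow_two, ← norm_mul, dampedRoot_mul_self, norm_mul, add_comm]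
  have h2 := sin_mul_norm_le_norm_add hδ hz hα
  have h3 := Real.sin_le_one δ
  have hn := norm_nonneg z
  rw [h1]
  calc (Real.sin δ * ‖z‖) ^ 2 = ‖z‖ * (Real.sin δ * (Real.sin δ * ‖z‖)) := by ring
    _ ≤ ‖z‖ * (1 * (Real.sin δ * ‖z‖)) := by gcongr
    _ ≤ ‖z‖ * ‖(α : ℂ) + z‖ := by rw [one_mul]; gcongr

lemma differentiableAt_dampedRoot {α : ℝ} (hα : 0 ≤ α) {z : ℂ} (hz : z ∈ Complex.slitPlane) :
    DifferentiableAt ℂ (dampedRoot α) z :=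
  (differentiableAt_id.cpow_const hz).mul
    ((differentiableAt_id.add_const (α : ℂ)).cpow_const (add_ofReal_mem_slitPlane hα hz))

lemma norm_exp_mul_exp_neg_dampedRoot_le {α d : ℝ} (hα : 0 ≤ α) (hd : 0 ≤ d) {z : ℂ}
    (hz : z ∈ Complex.slitPlane) :
    ‖Complex.exp (z * (d : ℂ)) * Complex.exp (-(dampedRoot α z * (d : ℂ)))‖
      ≤ Real.exp (α * d) := by
  rw [← Complex.exp_add, Complex.norm_exp, Real.exp_le_exp]
  refine (Complex.re_le_norm _).trans ?_
  rw [show z * (d : ℂ) + -(dampedRoot α z * (d : ℂ)) = -(dampedRoot α z - z) * (d : ℂ) by ring,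
    norm_mul, norm_neg, Complex.norm_real, Real.norm_of_nonneg hd]
  exact mul_le_mul_of_nonneg_right (norm_dampedRoot_sub_le hα hz) hd

/-! ### Analyticity and bounds for the transfer functions. -/

lemma mul_ofReal_mem_slitPlane {r : ℝ} (hr : 0 < r) {z : ℂ} (hz : z ∈ Complex.slitPlane) :
    z * (r : ℂ) ∈ Complex.slitPlane := by
  rw [Complex.mem_slitPlane_iff_arg, Complex.arg_mul_real hr]
  exact ⟨(Complex.mem_slitPlane_iff_arg.1 hz).1,
    mul_ne_zero (Complex.slitPlane_ne_zero hz) (Complex.ofReal_ne_zero.2 hr.ne')⟩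

lemma analyticOnNhd_transfer2D {α d : ℝ} (hα : 0 ≤ α) (hd : 0 < d) :
    AnalyticOnNhd ℂ (fun z => transfer2D α z d) Complex.slitPlane := by
  refine DifferentiableOn.analyticOnNhd (fun z hz => ?_) Complex.isOpen_slitPlane
  have hw := mul_ofReal_mem_slitPlane hd (dampedRoot_mem_slitPlane hα hz)
  have h := (hasDerivAt_besselK0 hw).differentiableAt.comp z
    ((differentiableAt_dampedRoot hα hz).mul_const (d : ℂ))
  exact (h.const_mul _).differentiableWithinAt

lemma analyticOnNhd_transfer3D {α : ℝ} (hα : 0 ≤ α) (d : ℝ) :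
    AnalyticOnNhd ℂ (fun z => transfer3D α z d) Complex.slitPlane := by
  refine DifferentiableOn.analyticOnNhd (fun z hz => ?_) Complex.isOpen_slitPlane
  exact (((differentiableAt_dampedRoot hα hz).mul_const (d : ℂ)).neg.cexp.div_const
    _).differentiableWithinAt

lemma norm_exp_mul_transfer2D_le {α δ d : ℝ} (hα : 0 ≤ α) (hδ : δ ∈ Ioo 0 (Real.pi / 2))
    (hd : 0 < d) {z : ℂ} (hz : z ∈ sector δ) :
    ‖Complex.exp (z * (d : ℂ)) * transfer2D α z d‖
      ≤ 1 / (2 * Real.pi) * Real.exp (α * d) * (∫ u in Ioi (0 : ℝ), gammaWeight u)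
        * (2 * Real.sin δ ^ 2 * d) ^ (-1 / 2 : ℝ) * ‖z‖ ^ (-1 / 2 : ℝ) := by
  have hsl := sector_subset_slitPlane hδ.1.le hz
  have hsin : 0 < Real.sin δ :=
    Real.sin_pos_of_pos_of_lt_pi hδ.1 (by linarith [hδ.2, Real.pi_pos])
  have hz0 : 0 < ‖z‖ := norm_pos_iff.2 hz.1
  have hw := mul_ofReal_mem_sector hd (dampedRoot_mem_sector hα hδ.1.le hz)
  set w := dampedRoot α z * (d : ℂ) with hwdef
  -- One factor `sin δ` is the distance from `2w` to the negative axis, the other compares the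
  -- damped root with `z`.
  have hlow : ∀ u : ℝ, 0 ≤ u → 2 * Real.sin δ ^ 2 * d * ‖z‖ ≤ ‖(u : ℂ) + 2 * w‖ := by
    intro u hu
    have h1 := sin_mul_norm_le_norm_add hδ (mul_ofReal_mem_sector two_pos hw) hu
    rw [norm_mul, Complex.norm_real, hwdef, norm_mul, Complex.norm_real,
      Real.norm_of_nonneg hd.le, Real.norm_of_nonneg two_pos.le, Complex.ofReal_ofNat,
      mul_comm _ (2 : ℂ)] at h1
    refine le_trans ?_ h1
    calc 2 * Real.sin δ ^ 2 * d * ‖z‖ = Real.sin δ * ((Real.sin δ * ‖z‖) * d * 2) := by ring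
      _ ≤ _ := by gcongr; exact sin_mul_norm_le_norm_dampedRoot hα hδ hz
  have hF := norm_laplaceIntegral_le (s := 1 / 2) (by norm_num) (by positivity) hlow
  rw [Real.mul_rpow (by positivity) hz0.le, ← neg_div] at hF
  have hE := norm_exp_mul_exp_neg_dampedRoot_le hα hd.le hsl
  have e : Complex.exp (z * (d : ℂ)) * transfer2D α z d = 1 / (2 * (Real.pi : ℂ))
      * (Complex.exp (z * (d : ℂ)) * Complex.exp (-w)) * laplaceIntegral (1 / 2) w := by
    rw [transfer2D, besselK0_eq_laplaceK (sector_subset_slitPlane hδ.1.le hw), laplaceK]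
    ring
  have hpi : ‖(1 / (2 * (Real.pi : ℂ)))‖ = 1 / (2 * Real.pi) := by
    rw [norm_div, norm_mul, Complex.norm_real, Real.norm_of_nonneg Real.pi_pos.le]
    simp
  rw [e, norm_mul, norm_mul, hpi]
  calc _ ≤ 1 / (2 * Real.pi) * Real.exp (α * d) * ((∫ u in Ioi (0 : ℝ), gammaWeight u)
        * ((2 * Real.sin δ ^ 2 * d) ^ (-1 / 2 : ℝ) * ‖z‖ ^ (-1 / 2 : ℝ))) := by
        have := Real.pi_pos
        gcongr
    _ = _ := by ring

lemma norm_exp_mul_transfer3D_le {α d : ℝ} (hα : 0 ≤ α) (hd : 0 < d) {z : ℂ}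
    (hz : z ∈ Complex.slitPlane) :
    ‖Complex.exp (z * (d : ℂ)) * transfer3D α z d‖ ≤ Real.exp (α * d) / (4 * Real.pi * d) := by
  have hpi : ‖(4 * (Real.pi : ℂ) * (d : ℂ))‖ = 4 * Real.pi * d := by
    rw [norm_mul, norm_mul, Complex.norm_real, Complex.norm_real,
      Real.norm_of_nonneg Real.pi_pos.le, Real.norm_of_nonneg hd.le]
    simp
  rw [transfer3D, ← mul_div_assoc, norm_div, hpi]
  have := Real.pi_pos
  gcongr
  exact norm_exp_mul_exp_neg_dampedRoot_le hα hd.le hz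

end WaveKernel

end

theorem lemma5p1 (α : ℝ) (hα : 0 ≤ α) (δ : ℝ) (hδ : δ ∈ Set.Ioo 0 (Real.pi / 2))
    (d : ℝ) (hd : 0 < d) :
    WaveKernel.ShiftedSectorialBound (WaveKernel.transfer2D α) δ (-1 / 2) d ∧
      WaveKernel.ShiftedSectorialBound (WaveKernel.transfer3D α) δ 0 d := by
  have hsub := WaveKernel.sector_subset_slitPlane hδ.1.le
  refine ⟨⟨(WaveKernel.analyticOnNhd_transfer2D hα hd).mono hsub, _,
    fun z hz => WaveKernel.norm_exp_mul_transfer2D_le hα hδ hd hz⟩,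
    ⟨(WaveKernel.analyticOnNhd_transfer3D hα d).mono hsub,
      Real.exp (α * d) / (4 * Real.pi * d), fun z hz => ?_⟩⟩
  rw [Real.rpow_zero, mul_one]
  exact WaveKernel.norm_exp_mul_transfer3D_le hα hd (hsub hz)
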